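/- \textbf{Theorem.} For elements of a group write $x^y = y^{-1}xy$ and $[x,y]=x^{-1}y^{-1}xy$. For a group $G$ and an integer $q\ge 1$, the $q$-tensor square $G\otimes^q G$ is the group generated by symbols $g\otimes h$ and $\widehat{k}$ $(g,h,k\in G)$ subject to the relations, for all $g,g_1,h,h_1,k,k_1\in G$, \begin{align*} g\otimes hh_1 &= (g\otimes h_1)(g^{h_1}\otimes h^{h_1}), & (1)\\ gg_1\otimes h &= (g^{g_1}\otimes h^{g_1})(g_1\otimes h), & (2)\\ (g\otimes h)^{\widehat{k}} &= g^{(k^q)}\otimes h^{(k^q)}, & (3)\\ \widehat{kk_1} &= \widehat{k}\,\Bigl(\prod_{i=1}^{q-1}\bigl(k\otimes (k_1^{-i})^{k^{q-1-i}}\bigr)\Bigr)\,\widehat{k_1}, & (4)\\ [\widehat{k},\widehat{k_1}] &= k^q\otimes k_1^q, & (5)\\ \widehat{[g,h]} &= (g\otimes h)^q, & (6) \end{align*} where the factors in (4) are taken in increasing order of $i$. For $q=0$, $G\otimes^0 G$ is the non-abelian tensor square $G\otimes G$, generated by the symbols $g\otimes h$ $(g,h\in G)$ subject to (1) and (2)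 only. Let $G$ be a finite nilpotent group of class at most $3$ with $\exp G = n$, and let $q\ge 0$ be an integer. Then (i) $\exp(G\otimes^q G)$ divides $\exp G$ if either $n$ is odd or $4\mid q$; (ii) $\exp(G\otimes^q G)$ divides $2\exp G$ otherwise. -/

import Mathlib

namespace QTensor

/-- The conjugate `x ^ y = y⁻¹ x y`. -/
def rconj {G : Type*} [Group G] (x y : G) : G := y⁻¹ * x * y

/-- The commutator `[x, y] = x⁻¹ y⁻¹ x y`. -/
def rcomm {G : Type*} [Group G] (x y : G) : G := x⁻¹ * y⁻¹ * x * y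

/-- The generating symbols of the `q`-tensor square of `G`: a symbol `g ⊗ h` for all `g h : G` and,
only when `q ≥ 1`, a symbol `k̂` for every `k : G`. -/
inductive Gen (G : Type*) (q : ℕ) : Type _
  | tens (g h : G) : Gen G q
  | hat (hq : 1 ≤ q) (k : G) : Gen G q

/-- The symbol `g ⊗ h` as a word. -/
def tens {G : Type*} {q : ℕ} (g h : G) : FreeGroup (Gen G q) := FreeGroup.of (Gen.tens g h)

/-- The symbol `k̂` as a word (`q ≥ 1`). -/
def hat {G : Type*} {q : ℕ} (hq : 1 ≤ q) (k : G) : FreeGroup (Gen G q) :=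
  FreeGroup.of (Gen.hat hq k)

/-- `Rel G q u v` says that `u = v` is one of the defining relations of the `q`-tensor square of
`G`. For `q = 0` there are only the relations `mul_right` and `mul_left`, those of the non-abelian
tensor square. The product in `hat_mul` is taken over `i = 1, …, q - 1` in increasing order. -/
inductive Rel (G : Type*) [Group G] (q : ℕ) : FreeGroup (Gen G q) → FreeGroup (Gen G q) → Prop
  | mul_right (g h h₁ : G) :
      Rel G q (tens g (h * h₁)) (tens g h₁ * tens (rconj g h₁) (rconj h h₁))
  | mul_left (g g₁ h : G) :
      Rel G q (tens (g * g₁) h) (tens (rconj g g₁) (rconj h g₁) * tens g₁ h)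
  | conj_hat (hq : 1 ≤ q) (g h k : G) :
      Rel G q (rconj (tens g h) (hat hq k)) (tens (rconj g (k ^ q)) (rconj h (k ^ q)))
  | hat_mul (hq : 1 ≤ q) (k k₁ : G) :
      Rel G q (hat hq (k * k₁))
        (hat hq k *
          ((List.range' 1 (q - 1)).map fun i =>
            tens k (rconj (k₁ ^ i)⁻¹ (k ^ (q - 1 - i)))).prod *
          hat hq k₁)
  | comm_hat (hq : 1 ≤ q) (k k₁ : G) :
      Rel G q (rcomm (hat hq k) (hat hq k₁)) (tens (k ^ q) (k₁ ^ q))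
  | hat_comm (hq : 1 ≤ q) (g h : G) :
      Rel G q (hat hq (rcomm g h)) (tens g h ^ q)

end QTensor

/-- The `q`-tensor square `G ⊗^q G`, the group presented by the symbols `g ⊗ h` and `k̂` and the
relations above. -/
abbrev QTensorSquare (G : Type*) [Group G] (q : ℕ) : Type _ :=
  PresentedGroup {w : FreeGroup (QTensor.Gen G q) | ∃ u v, QTensor.Rel G q u v ∧ w = u * v⁻¹}

/-! Let `τ` be the subgroup of the `q`-tensor square generated by the symbols `g ⊗ h`. Elements of
`τ` behave like their boundaries in `G'`: if `m` lies over `c`, then `a` sends `m` to `m (c ⊗ a)`,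
and conjugation by `m` is the action of `c`. In class three `G'` is abelian and acts trivially on
every `c ⊗ x` with `c ∈ G'`, so these elements are central in `τ`. Collecting `(gh)^n = 1` shows
that `n.choose 2` kills `G'` (`commutator_pow_choose_two`), hence also every such `c ⊗ x`.

Expanding `gⁿ ⊗ h = 1` now gives `(g ⊗ h)ⁿ = 1` (`tau_pow`). Commutators in `τ` are central of order
dividing `n.choose 2`, so all of `τ` has exponent dividing `n` (`pow_eq_one_of_mem`). This settles
`q = 0`.

For `q ≥ 1` every element is `k̂ m` with `m ∈ τ`, and `(k̂ m)ⁿ = k̂ⁿ` (`mul_pow_eq_of_conj`).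
Relation (4) evaluated on powers of `k` gives `k̂ⁿ = (k ⊗ k)^(q.choose 2 * n.choose 2)`, and what
remains is the divisibility of that exponent by `n`. -/

namespace QTensor

/-! ### Commutator calculus and collection formulas. -/

section Group

variable {G : Type*} [Group G]

theorem rconj_mul_left (a b x : G) : rconj (a * b) x = rconj a x * rconj b x := by
  simp only [rconj]; group

theorem rconj_mul_right (a x y : G) : rconj a (x * y) = rconj (rconj a x) y := by
  simp only [rconj]; group

@[simp] theorem rconj_one_right (a : G) : rconj a 1 = a := by simp [rconj]

@[simp] theorem rconj_one_left (x : G) : rconj 1 x = 1 := by simp [rconj]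

/-- Conjugation by `x` as an endomorphism. -/
def rconjHom (x : G) : G →* G where
  toFun a := rconj a x
  map_one' := rconj_one_left x
  map_mul' a b := rconj_mul_left a b x

theorem map_rconj {H : Type*} [Group H] (f : G →* H) (a x : G) :
    f (rconj a x) = rconj (f a) (f x) := by simp [rconj]

theorem map_rcomm {H : Type*} [Group H] (f : G →* H) (a x : G) :
    f (rcomm a x) = rcomm (f a) (f x) := by simp [rcomm]

theorem rconj_eq_self {a x : G} (h : Commute a x) : rconj a x = a := by
  rw [rconj, mul_assoc, h.eq, inv_mul_cancel_left]

theorem rconj_eq_mul_rcomm (a x : G) : rconj a x = a * rcomm a x := by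
  simp only [rconj, rcomm]; group

theorem mul_eq_mul_rcomm (a x : G) : a * x = x * a * rcomm a x := by
  simp only [rcomm]; group

theorem rcomm_inv (a b : G) : (rcomm a b)⁻¹ = rcomm b a := by simp only [rcomm]; group

theorem rcomm_mem_commutator (a b : G) : rcomm a b ∈ commutator G := by
  have h := Subgroup.commutator_mem_commutator (Subgroup.mem_top (a⁻¹ : G))
    (Subgroup.mem_top (b⁻¹ : G))
  simpa [rcomm, commutatorElement_def, commutator_def] using h

theorem commutator_induction {P : G → Prop} (hc : ∀ a b, P (rcomm a b)) (h1 : P 1)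
    (hm : ∀ a b, P a → P b → P (a * b)) (hi : ∀ a, P a → P a⁻¹) {c : G}
    (h : c ∈ commutator G) : P c := by
  rw [commutator_eq_closure] at h
  induction h using Subgroup.closure_induction with
  | mem x hx =>
    obtain ⟨a, b, rfl⟩ := hx
    simpa [rcomm, commutatorElement_def] using hc a⁻¹ b⁻¹
  | one => exact h1
  | mul a b _ _ ha hb => exact hm a b ha hb
  | inv a _ ha => exact hi a ha

/-- Moving a power of `g` past `h` when `[h, g]` commutes with `[h, g, g]`. -/
theorem mul_pow_collect {g h d p : G} (hd : h * g = g * h * d) (hp : d * g = g * d * p)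
    (pg : Commute p g) (pd : Commute p d) (j : ℕ) :
    h * g ^ j = g ^ j * h * d ^ j * p ^ j.choose 2 := by
  have hdj : ∀ i : ℕ, d ^ i * g = g * d ^ i * p ^ i := by
    intro i
    induction i with
    | zero => simp
    | succ i ih =>
      calc d ^ (i + 1) * g = d ^ i * (d * g) := by rw [pow_succ, mul_assoc]
        _ = (d ^ i * g) * d * p := by rw [hp]; simp only [mul_assoc]
        _ = g * d ^ i * (p ^ i * d) * p := by rw [ih]; simp only [mul_assoc]
        _ = g * d ^ i * (d * p ^ i) * p := by rw [(pd.pow_left i).eq]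
        _ = g * d ^ (i + 1) * p ^ (i + 1) := by simp only [pow_succ, mul_assoc]
  induction j with
  | zero => simp
  | succ j ih =>
    have hc : (j + 1).choose 2 = j + j.choose 2 := by
      rw [Nat.choose_succ_succ' j 1, Nat.choose_one_right]
    calc h * g ^ (j + 1) = (h * g ^ j) * g := by rw [pow_succ, mul_assoc]
      _ = g ^ j * h * d ^ j * (p ^ j.choose 2 * g) := by rw [ih]; simp only [mul_assoc]
      _ = g ^ j * h * (d ^ j * g) * p ^ j.choose 2 := by
        rw [(pg.pow_left _).eq]; simp only [mul_assoc]
      _ = g ^ j * (h * g) * d ^ j * p ^ j * p ^ j.choose 2 := by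
        rw [hdj]; simp only [mul_assoc]
      _ = g ^ (j + 1) * h * d ^ (j + 1) * p ^ (j + 1).choose 2 := by
        rw [hd, hc, pow_succ g, pow_succ' d, pow_add p]; simp only [mul_assoc]

/-- The collection formula for `(g * h) ^ j` in class three. -/
theorem mul_pow_eq_of_central {g h d p r : G} (hd : h * g = g * h * d) (hp : d * g = g * d * p)
    (hr : d * h = h * d * r) (pc : ∀ x, Commute p x) (rc : ∀ x, Commute r x) (j : ℕ) :
    (g * h) ^ j = g ^ j * h ^ j * d ^ j.choose 2 * p ^ j.choose 3 *
      r ^ (j.choose 2 + 2 * j.choose 3) := by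
  have key : ∀ {x e z : G}, e * x = x * e * z → (∀ y, Commute z y) → ∀ i : ℕ,
      e ^ i * x = x * e ^ i * z ^ i := by
    intro x e z he hz i
    induction i with
    | zero => simp
    | succ i ih =>
      calc e ^ (i + 1) * x = e ^ i * (e * x) := by rw [pow_succ, mul_assoc]
        _ = (e ^ i * x) * e * z := by rw [he]; simp only [mul_assoc]
        _ = x * e ^ i * (z ^ i * e) * z := by rw [ih]; simp only [mul_assoc]
        _ = x * e ^ i * (e * z ^ i) * z := by rw [((hz e).pow_left i).eq]
        _ = x * e ^ (i + 1) * z ^ (i + 1) := by simp only [pow_succ, mul_assoc]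
  have hh : ∀ i : ℕ, h ^ i * g = g * h ^ i * d ^ i * r ^ i.choose 2 := by
    intro i
    induction i with
    | zero => simp
    | succ i ih =>
      have hc : (i + 1).choose 2 = i + i.choose 2 := by
        rw [Nat.choose_succ_succ' i 1, Nat.choose_one_right]
      calc h ^ (i + 1) * g = h ^ i * (h * g) := by rw [pow_succ, mul_assoc]
        _ = (h ^ i * g) * h * d := by rw [hd]; simp only [mul_assoc]
        _ = g * h ^ i * d ^ i * (r ^ i.choose 2 * (h * d)) := by rw [ih]; simp only [mul_assoc]
        _ = g * h ^ i * (d ^ i * h) * d * r ^ i.choose 2 := by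
          rw [((rc (h * d)).pow_left _).eq]; simp only [mul_assoc]
        _ = g * h ^ i * h * d ^ i * (r ^ i * d) * r ^ i.choose 2 := by
          rw [key hr rc]; simp only [mul_assoc]
        _ = g * h ^ (i + 1) * d ^ (i + 1) * r ^ (i + 1).choose 2 := by
          rw [((rc d).pow_left _).eq, hc, pow_succ h, pow_succ d, pow_add r]
          simp only [mul_assoc]
  induction j with
  | zero => simp
  | succ j ih =>
    have hc2 : (j + 1).choose 2 = j + j.choose 2 := by
      rw [Nat.choose_succ_succ' j 1, Nat.choose_one_right]
    have hc3 : (j + 1).choose 3 = j.choose 2 + j.choose 3 := Nat.choose_succ_succ' j 2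
    set A := j.choose 2
    set B := j.choose 3
    have e1 : d ^ A * g = g * d ^ A * p ^ A := key hp pc A
    have e2 : d ^ (j + A) * h = h * d ^ (j + A) * r ^ (j + A) := key hr rc _
    calc (g * h) ^ (j + 1)
        = g ^ j * h ^ j * d ^ A * ((p ^ B * r ^ (A + 2 * B)) * (g * h)) := by
          rw [pow_succ, ih]; simp only [mul_assoc]
      _ = g ^ j * h ^ j * (d ^ A * g) * h * (p ^ B * r ^ (A + 2 * B)) := by
          rw [((((pc (g * h)).pow_left B).mul_left ((rc (g * h)).pow_left _))).eq]
          simp only [mul_assoc]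
      _ = g ^ j * (h ^ j * g) * d ^ A * (p ^ A * h) * (p ^ B * r ^ (A + 2 * B)) := by
          rw [e1]; simp only [mul_assoc]
      _ = g ^ j * g * h ^ j * d ^ j * (r ^ A * (d ^ A * h)) * p ^ A *
            (p ^ B * r ^ (A + 2 * B)) := by
          rw [((pc h).pow_left A).eq, hh]; simp only [mul_assoc, A]
      _ = g ^ j * g * h ^ j * (d ^ (j + A) * h) * (r ^ A * p ^ (A + B)) * r ^ (A + 2 * B) := by
          rw [((rc (d ^ A * h)).pow_left A).eq, pow_add d, pow_add p]; simp only [mul_assoc]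
      _ = g ^ (j + 1) * h ^ (j + 1) * d ^ (j + A) * (r ^ (j + A) * (p ^ (A + B) * r ^ A)) *
            r ^ (A + 2 * B) := by
          rw [e2, ((rc (p ^ (A + B))).pow_left A).eq, pow_succ g, pow_succ h]
          simp only [mul_assoc]
      _ = _ := by
          rw [hc2, hc3, ((rc (p ^ (A + B) * r ^ A)).pow_left (j + A)).eq,
            show j + A + 2 * (A + B) = A + ((j + A) + (A + 2 * B)) by ring,
            pow_add r A (j + A + (A + 2 * B)), pow_add r (j + A) (A + 2 * B)]
          simp only [mul_assoc]

theorem three_mul_choose_three (n : ℕ) : 3 * n.choose 3 = n.choose 2 * (n - 2) := by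
  rw [mul_comm]
  exact Nat.choose_succ_right_eq n 2

/-! ### Class three: orders of commutators. -/

variable (hG : ∀ a b c : G, rcomm (rcomm a b) c ∈ Subgroup.center G)
include hG

theorem rcomm_mem_center {c : G} (hc : c ∈ commutator G) (a : G) :
    rcomm c a ∈ Subgroup.center G := by
  refine commutator_induction (P := fun c => rcomm c a ∈ Subgroup.center G)
    (fun x y => hG x y a) (by simp [rcomm, one_mem]) (fun x y hx hy => ?_) (fun x hx => ?_) hc
  · have : rcomm (x * y) a = rconj (rcomm x a) y * rcomm y a := by
      simp only [rcomm, rconj]; group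
    rw [this, rconj_eq_self (Subgroup.mem_center_iff.1 hx y).symm]
    exact mul_mem hx hy
  · have : rcomm x⁻¹ a = rconj (rcomm x a)⁻¹ x⁻¹ := by simp only [rcomm, rconj]; group
    have hx' := inv_mem hx
    rw [this, rconj_eq_self (Subgroup.mem_center_iff.1 hx' _).symm]
    exact hx'

/-- For `d ∈ G'` the map `a ↦ [d, a]` is a homomorphism into the centre, so it kills commutators.
The calculation compares `d` moved past `ab` and past `ba`. -/
theorem commutator_commute {c d : G} (hc : c ∈ commutator G) (hd : d ∈ commutator G) :
    Commute c d := by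
  refine commutator_induction (P := fun c => Commute c d) (fun a b => ?_) (Commute.one_left d)
    (fun _ _ => Commute.mul_left) (fun _ => Commute.inv_left) hc
  have ha := fun x => Subgroup.mem_center_iff.1 (rcomm_mem_center hG hd a) x
  have hb := fun x => Subgroup.mem_center_iff.1 (rcomm_mem_center hG hd b) x
  have h1 : d * (a * b) = a * b * d * rcomm d a * rcomm d b := by
    calc d * (a * b) = (d * a) * b := by rw [mul_assoc]
      _ = a * d * (rcomm d a * b) := by rw [mul_eq_mul_rcomm d a]; simp only [mul_assoc]
      _ = a * (d * b) * rcomm d a := by rw [← ha b]; simp only [mul_assoc]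
      _ = a * b * d * (rcomm d b * rcomm d a) := by
        rw [mul_eq_mul_rcomm d b]; simp only [mul_assoc]
      _ = _ := by rw [ha]; simp only [mul_assoc]
  have h2 : d * (b * a) = b * a * d * rcomm d a * rcomm d b := by
    calc d * (b * a) = (d * b) * a := by rw [mul_assoc]
      _ = b * d * (rcomm d b * a) := by rw [mul_eq_mul_rcomm d b]; simp only [mul_assoc]
      _ = b * (d * a) * rcomm d b := by rw [← hb a]; simp only [mul_assoc]
      _ = _ := by rw [mul_eq_mul_rcomm d a]; simp only [mul_assoc]
  have h3 : a * b = b * a * rcomm a b := mul_eq_mul_rcomm a b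
  have h4 : (b * a) * (d * rcomm a b) = (b * a) * (rcomm a b * d) := by
    have e : d * (b * a) * rcomm a b = a * b * d * rcomm d a * rcomm d b := by
      rw [mul_assoc, ← h3, h1]
    rw [h2] at e
    have e' : b * a * d * rcomm a b * (rcomm d a * rcomm d b) =
        a * b * d * (rcomm d a * rcomm d b) := by
      rw [← mul_assoc (a * b * d), ← e]
      simp only [mul_assoc]
      rw [← hb, ← mul_assoc (rcomm a b), ha, mul_assoc]
    have e'' := mul_right_cancel e'
    rw [h3] at e''
    simpa only [mul_assoc] using e''
  exact (mul_left_cancel h4).symm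

theorem rcomm_rcomm_eq_inv (h g : G) : rcomm (rcomm h g) g = (rcomm (rcomm g h) g)⁻¹ := by
  have pc := Subgroup.mem_center_iff.1 (inv_mem (hG g h g)) (rcomm h g)
  have : rcomm (rcomm h g) g = rconj (rcomm (rcomm g h) g)⁻¹ (rcomm h g) := by
    simp only [rcomm, rconj]; group
  rw [this, rconj_eq_self pc.symm]

variable {n : ℕ} (hn : ∀ x : G, x ^ n = 1)
include hn

/-- Move `h` past `gⁿ = 1`: only the triple commutator survives. -/
theorem rcomm_rcomm_pow_choose_two (h g : G) : rcomm (rcomm h g) g ^ n.choose 2 = 1 := by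
  have pc := fun x => Subgroup.mem_center_iff.1 (hG h g g) x
  have := mul_pow_collect (mul_eq_mul_rcomm h g) (mul_eq_mul_rcomm (rcomm h g) g)
    (pc g).symm (pc _).symm n
  rw [hn, hn] at this
  simpa using this

theorem rcomm_pow_relation (h g : G) : rcomm h g ^ n.choose 2 *
    rcomm (rcomm h g) g ^ n.choose 3 *
    rcomm (rcomm h g) h ^ (n.choose 2 + 2 * n.choose 3) = 1 := by
  have := mul_pow_eq_of_central (mul_eq_mul_rcomm h g) (mul_eq_mul_rcomm (rcomm h g) g)
    (mul_eq_mul_rcomm (rcomm h g) h) (fun x => (Subgroup.mem_center_iff.1 (hG h g g) x).symm)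
    (fun x => (Subgroup.mem_center_iff.1 (hG h g h) x).symm) n
  rw [hn, hn, hn] at this
  simpa using this.symm

/-- Replacing `h` by `h⁻¹` in `rcomm_pow_relation` inverts the contributions of `d` and `p` but not
that of `r`, so comparing the two relations kills `r ^ (4 * n.choose 3)`. Since `3 * n.choose 3` is
a multiple of `n.choose 2`, it kills `r` too, and `4 - 3 = 1`. -/
theorem rcomm_rcomm_pow_choose_three (h g : G) : rcomm (rcomm h g) g ^ n.choose 3 = 1 := by
  suffices H : ∀ h g : G, rcomm (rcomm h g) h ^ n.choose 3 = 1 by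
    rw [rcomm_rcomm_eq_inv hG, inv_pow, H, inv_one]
  intro h g
  set d := rcomm h g with hd
  set p := rcomm d g with hp
  set r := rcomm d h with hr
  have pc : ∀ x, Commute p x := fun x => (Subgroup.mem_center_iff.1 (hG h g g) x).symm
  have rc : ∀ x, Commute r x := fun x => (Subgroup.mem_center_iff.1 (hG h g h) x).symm
  have r2 : r ^ n.choose 2 = 1 := by
    have := rcomm_rcomm_pow_choose_two hG hn g h
    rwa [rcomm_rcomm_eq_inv hG, inv_pow, inv_eq_one] at this
  have d' : rcomm h⁻¹ g = d⁻¹ * r := by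
    have : rcomm h⁻¹ g = h * d⁻¹ * h⁻¹ := by rw [hd]; simp only [rcomm]; group
    rw [this]
    have e : d * h = h * d * r := mul_eq_mul_rcomm d h
    have e2 : h * d⁻¹ = d⁻¹ * r * h := by
      rw [mul_assoc, (rc h).eq, eq_comm, inv_mul_eq_iff_eq_mul, ← mul_assoc, e, mul_assoc (h * d),
        (rc _).eq]
      group
    rw [e2, mul_inv_cancel_right]
  have p' : rcomm (d⁻¹ * r) g = p⁻¹ := by
    have : rcomm (d⁻¹ * r) g = rconj (rcomm d⁻¹ g) r * rcomm r g := by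
      simp only [rcomm, rconj]; group
    rw [this, rconj_eq_self (rc _).symm]
    have e : rcomm r g = 1 := by
      rw [rcomm, mul_assoc, mul_assoc, (rc g).eq]; group
    have e2 : rcomm d⁻¹ g = rconj p⁻¹ d⁻¹ := by rw [hp]; simp only [rcomm, rconj]; group
    rw [e, e2, rconj_eq_self ((pc _).inv_left), mul_one]
  have r' : rcomm (d⁻¹ * r) h⁻¹ = r := by
    have : rcomm (d⁻¹ * r) h⁻¹ = rconj (rcomm d⁻¹ h⁻¹) r * rcomm r h⁻¹ := by
      simp only [rcomm, rconj]; group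
    rw [this, rconj_eq_self (rc _).symm]
    have e : rcomm r h⁻¹ = 1 := by
      rw [rcomm, mul_assoc, mul_assoc, (rc _).eq]; group
    have e2 : rcomm d⁻¹ h⁻¹ = rconj r (h⁻¹ * d⁻¹) := by
      rw [hr]; simp only [rcomm, rconj]; group
    rw [e, e2, rconj_eq_self (rc _), mul_one]
  have E1 : d ^ n.choose 2 * p ^ n.choose 3 * r ^ (n.choose 2 + 2 * n.choose 3) = 1 :=
    rcomm_pow_relation hG hn h g
  have E2 := rcomm_pow_relation hG hn h⁻¹ g
  rw [d', p', r', (rc _).symm.mul_pow, r2, mul_one, inv_pow, inv_pow] at E2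
  rw [pow_add, r2, one_mul] at E1 E2
  have E3 : r ^ (4 * n.choose 3) = 1 := by
    have a1 := eq_inv_of_mul_eq_one_left E1
    have a2 : (d ^ n.choose 2 * p ^ n.choose 3)⁻¹ * r ^ (2 * n.choose 3) = 1 := by
      rw [mul_inv_rev, ← ((pc (d ^ n.choose 2)⁻¹).pow_left _).inv_left.eq.symm]
      exact E2
    rw [a1, inv_inv, ← pow_add] at a2
    rw [← a2]; congr 1; ring
  have E4 : r ^ (3 * n.choose 3) = 1 := by
    rw [three_mul_choose_three, pow_mul, r2, one_pow]
  calc r ^ n.choose 3 = r ^ (3 * n.choose 3) * r ^ n.choose 3 := by rw [E4, one_mul]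
    _ = r ^ (4 * n.choose 3) := by rw [← pow_add]; congr 1; ring
    _ = 1 := E3

/-- Both binomial coefficients kill the triple commutators, so the collected relation reduces to
this for a single commutator; `G'` being abelian extends it to products. -/
theorem commutator_pow_choose_two {c : G} (hc : c ∈ commutator G) : c ^ n.choose 2 = 1 := by
  refine (commutator_induction (P := fun c => c ∈ commutator G ∧ c ^ n.choose 2 = 1)
    (fun h g => ⟨rcomm_mem_commutator h g, ?_⟩) ⟨one_mem _, one_pow _⟩
    (fun a b ha hb => ⟨mul_mem ha.1 hb.1, ?_⟩)
    (fun a ha => ⟨inv_mem ha.1, by rw [inv_pow, ha.2, inv_one]⟩) hc).2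
  · have E := rcomm_pow_relation hG hn h g
    have r2 := rcomm_rcomm_pow_choose_two hG hn g h
    have r3 := rcomm_rcomm_pow_choose_three hG hn g h
    rw [rcomm_rcomm_eq_inv hG, inv_pow, inv_eq_one] at r2 r3
    rw [rcomm_rcomm_pow_choose_three hG hn, pow_add, mul_comm 2, pow_mul, r2, r3] at E
    simpa using E
  · rw [(commutator_commute hG ha.1 hb.1).mul_pow, ha.2, hb.2, one_mul]

end Group

/-! ### Tensor pairings and boundaries. -/

/-- A biderivation `tau : G × G → T` together with a compatible right action of `G` on `T` that
factors through the inner automorphisms of `G`. -/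
structure TensorPairing (G T : Type*) [Group G] [Group T] where
  tau : G → G → T
  act : G → T →* T
  act_tau : ∀ k g h, act k (tau g h) = tau (rconj g k) (rconj h k)
  act_mul : ∀ a b t, act (a * b) t = act b (act a t)
  act_center : ∀ x ∈ Subgroup.center G, ∀ t, act x t = t
  tau_mul_right : ∀ g h h₁, tau g (h * h₁) = tau g h₁ * act h₁ (tau g h)
  tau_mul_left : ∀ g g₁ h, tau (g * g₁) h = act g₁ (tau g h) * tau g₁ h

namespace TensorPairing

variable {G T : Type*} [Group G] [Group T] (P : TensorPairing G T)

theorem act_one (t : T) : P.act 1 t = t := P.act_center 1 (one_mem _) t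

theorem act_act_inv (a : G) (t : T) : P.act a (P.act a⁻¹ t) = t := by
  rw [← P.act_mul, inv_mul_cancel, act_one]

@[simp] theorem tau_one_left (h : G) : P.tau 1 h = 1 := by
  simpa [act_one] using P.tau_mul_left 1 1 h

@[simp] theorem tau_one_right (g : G) : P.tau g 1 = 1 := by
  simpa [act_one] using P.tau_mul_right g 1 1

/-- The subgroup generated by the values of the pairing. -/
def range : Subgroup T := Subgroup.closure {t | ∃ g h, t = P.tau g h}

theorem tau_mem (g h : G) : P.tau g h ∈ P.range := Subgroup.subset_closure ⟨g, h, rfl⟩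

theorem act_mem (a : G) {m : T} (hm : m ∈ P.range) : P.act a m ∈ P.range := by
  induction hm using Subgroup.closure_induction with
  | mem x hx =>
    obtain ⟨g, h, rfl⟩ := hx
    rw [P.act_tau]
    exact P.tau_mem _ _
  | one => rw [map_one]; exact one_mem _
  | mul x y _ _ hx hy => rw [map_mul]; exact mul_mem hx hy
  | inv x _ hx => rw [map_inv]; exact inv_mem hx

/-- Expand `gg₁ ⊗ hh₁` in both orders and cancel the common outer factors. -/
theorem mul_tau_eq_tau_mul (g h g₁ h₁ : G) :
    P.tau g₁ h₁ * P.act (g₁ * h₁) (P.tau g h) = P.act (h₁ * g₁) (P.tau g h) * P.tau g₁ h₁ := by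
  have e1 := P.tau_mul_right (g * g₁) h h₁
  rw [P.tau_mul_left g g₁ (h * h₁), P.tau_mul_right g h h₁, P.tau_mul_right g₁ h h₁,
    P.tau_mul_left g g₁ h₁, P.tau_mul_left g g₁ h, map_mul, map_mul] at e1
  simp only [mul_assoc, mul_left_cancel_iff] at e1
  simp only [← mul_assoc, mul_right_cancel_iff] at e1
  rw [P.act_mul, P.act_mul, e1]

/-- Conjugation by `g ⊗ h` is the action of `[g, h]`. -/
theorem conj_tau {m : T} (hm : m ∈ P.range) (g h : G) :
    (P.tau g h)⁻¹ * m * P.tau g h = P.act (rcomm g h) m := by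
  induction hm using Subgroup.closure_induction with
  | mem x hx =>
    obtain ⟨a, b, rfl⟩ := hx
    -- Pulling back by `hg` makes one side of the exchange identity `a ⊗ b` itself; the other side
    -- is then moved by `(hg)⁻¹gh = [g, h]`.
    set y := P.act (h * g)⁻¹ (P.tau a b) with hy
    have e := P.mul_tau_eq_tau_mul (rconj a (h * g)⁻¹) (rconj b (h * g)⁻¹) g h
    rw [← P.act_tau, P.act_act_inv, ← P.act_mul] at e
    rw [mul_assoc, ← e, inv_mul_cancel_left]
    congr 1
    congr 1
    simp only [rcomm]; group
  | one => simp
  | mul x y _ _ hx hy => rw [map_mul, ← hx, ← hy]; group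
  | inv x _ hx => rw [map_inv, ← hx]; group

/-- Compare two expansions of `g ⊗ ha`, the second one through `ha = (hah⁻¹)h`, and use `[g, h] =
g⁻¹g^h`. -/
theorem act_tau_eq_mul (g h a : G) :
    P.act a (P.tau g h) = P.tau g h * P.tau (rcomm g h) a := by
  have e1 : P.tau g (h * a) = P.tau g a * P.act a (P.tau g h) := P.tau_mul_right g h a
  have e2 : P.tau g (h * a) = P.tau g h * P.tau (rconj g h) a := by
    have := P.tau_mul_right g (rconj a h⁻¹) h
    rw [P.act_tau, ← rconj_mul_right a, inv_mul_cancel, rconj_one_right] at this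
    rw [← this]; congr 1; simp only [rconj]; group
  have e3 : rcomm g h = g⁻¹ * rconj g h := by simp only [rconj, rcomm]; group
  have e4 : P.act g (P.tau g⁻¹ a) = (P.tau g a)⁻¹ := by
    have := P.tau_mul_left g⁻¹ g a
    rw [inv_mul_cancel, tau_one_left] at this
    exact eq_inv_of_mul_eq_one_left this.symm
  have e5 : P.act (rconj g h) (P.tau g⁻¹ a) =
      (P.tau g h)⁻¹ * (P.tau g a)⁻¹ * P.tau g h := by
    rw [P.conj_tau (inv_mem (P.tau_mem g a)), ← e4, ← P.act_mul]
    congr 2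
    simp only [rconj, rcomm]; group
  calc P.act a (P.tau g h) = (P.tau g a)⁻¹ * (P.tau g h * P.tau (rconj g h) a) := by
        rw [← e2, e1, inv_mul_cancel_left]
    _ = P.tau g h * (((P.tau g h)⁻¹ * (P.tau g a)⁻¹ * P.tau g h) * P.tau (rconj g h) a) := by
        group
    _ = P.tau g h * P.tau (rcomm g h) a := by rw [← e5, ← P.tau_mul_left, ← e3]

/-- `m` lies over `c`: the boundary of `m` in `G` is `c`. -/
structure Over (m : T) (c : G) : Prop where
  mem : m ∈ P.range
  mem_commutator : c ∈ commutator G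
  act_eq : ∀ a, P.act a m = m * P.tau c a
  conj_eq : ∀ s ∈ P.range, m⁻¹ * s * m = P.act c s

theorem over_tau (g h : G) : P.Over (P.tau g h) (rcomm g h) where
  mem := P.tau_mem g h
  mem_commutator := rcomm_mem_commutator g h
  act_eq := P.act_tau_eq_mul g h
  conj_eq _ hs := P.conj_tau hs g h

theorem over_one : P.Over 1 1 where
  mem := one_mem _
  mem_commutator := one_mem _
  act_eq := by simp
  conj_eq := by simp [act_one]

variable {P}

theorem Over.mul {m m' : T} {c c' : G} (h : P.Over m c) (h' : P.Over m' c') :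
    P.Over (m * m') (c * c') where
  mem := mul_mem h.mem h'.mem
  mem_commutator := mul_mem h.mem_commutator h'.mem_commutator
  act_eq a := by
    rw [map_mul, h.act_eq, h'.act_eq, P.tau_mul_left, ← h'.conj_eq _ (P.tau_mem c a)]
    group
  conj_eq s hs := by
    rw [P.act_mul, ← h.conj_eq s hs, ← h'.conj_eq _ (mul_mem (mul_mem (inv_mem h.mem) hs) h.mem)]
    group

theorem Over.inv {m : T} {c : G} (h : P.Over m c) : P.Over m⁻¹ c⁻¹ := by
  have conj : ∀ s ∈ P.range, m⁻¹⁻¹ * s * m⁻¹ = P.act c⁻¹ s := by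
    intro s hs
    have e := h.conj_eq _ (P.act_mem c⁻¹ hs)
    rw [P.act_act_inv] at e
    generalize P.act c⁻¹ s = z at e ⊢
    rw [← e]; group
  refine ⟨inv_mem h.mem, inv_mem h.mem_commutator, fun a => ?_, conj⟩
  have e := P.tau_mul_left c c⁻¹ a
  rw [mul_inv_cancel, tau_one_left, ← conj _ (P.tau_mem c a)] at e
  rw [map_inv, h.act_eq, eq_inv_of_mul_eq_one_right e.symm]
  group

variable (P)

theorem exists_over_of_mem {m : T} (hm : m ∈ P.range) : ∃ c, P.Over m c := by
  induction hm using Subgroup.closure_induction with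
  | mem x hx =>
    obtain ⟨g, h, rfl⟩ := hx
    exact ⟨_, P.over_tau g h⟩
  | one => exact ⟨1, P.over_one⟩
  | mul x y _ _ hx hy =>
    obtain ⟨c, hc⟩ := hx
    obtain ⟨d, hd⟩ := hy
    exact ⟨_, hc.mul hd⟩
  | inv x _ hx =>
    obtain ⟨c, hc⟩ := hx
    exact ⟨_, hc.inv⟩

theorem exists_over_of_mem_commutator {c : G} (hc : c ∈ commutator G) : ∃ m, P.Over m c :=
  commutator_induction (P := fun c => ∃ m, P.Over m c) (fun a b => ⟨_, P.over_tau a b⟩)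
    ⟨1, P.over_one⟩ (fun _ _ ⟨_, ha⟩ ⟨_, hb⟩ => ⟨_, ha.mul hb⟩) (fun _ ⟨_, ha⟩ => ⟨_, ha.inv⟩) hc

/-- For `m` over `c`, the factor by which `x` moves `m` is `c ⊗ x`, but central elements act
trivially. -/
theorem tau_center {c x : G} (hc : c ∈ commutator G) (hx : x ∈ Subgroup.center G) :
    P.tau c x = 1 := by
  obtain ⟨m, hm⟩ := P.exists_over_of_mem_commutator hc
  have := hm.act_eq x
  rw [P.act_center x hx] at this
  exact left_eq_mul.1 this

/-- If `c` fixes `c ⊗ x`, then `c ^ j ⊗ x = (c ⊗ x) ^ j`. -/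
theorem tau_pow_left {c x : G} (h : P.act c (P.tau c x) = P.tau c x) (j : ℕ) :
    P.tau (c ^ j) x = P.tau c x ^ j := by
  induction j with
  | zero => simp
  | succ j ih => rw [pow_succ, P.tau_mul_left, ih, map_pow, h, pow_succ]

theorem tau_pow_right {c x : G} (h : P.act x (P.tau c x) = P.tau c x) (j : ℕ) :
    P.tau c (x ^ j) = P.tau c x ^ j := by
  induction j with
  | zero => simp
  | succ j ih => rw [pow_succ, P.tau_mul_right, ih, map_pow, h, pow_succ']

/-! ### The exponent of the tensor subgroup in class three. -/

section ClassThree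

variable (hG : ∀ a b c : G, rcomm (rcomm a b) c ∈ Subgroup.center G)
include hG

/-- Conjugation by `d` fixes `c` and changes `x` by a central factor, which `c ⊗ -` does not see. -/
theorem act_commutator_tau {c d : G} (hc : c ∈ commutator G) (hd : d ∈ commutator G) (x : G) :
    P.act d (P.tau c x) = P.tau c x := by
  have hz : rcomm x d ∈ Subgroup.center G := by
    rw [← rcomm_inv]; exact inv_mem (rcomm_mem_center hG hd x)
  rw [P.act_tau, rconj_eq_self (commutator_commute hG hc hd), rconj_eq_mul_rcomm,
    P.tau_mul_right, P.tau_center hc hz, one_mul, P.act_center _ hz]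

theorem commute_tau {c : G} (hc : c ∈ commutator G) (x : G) {m : T} (hm : m ∈ P.range) :
    Commute m (P.tau c x) := by
  obtain ⟨d, hd⟩ := P.exists_over_of_mem hm
  have e := hd.conj_eq _ (P.tau_mem c x)
  rw [P.act_commutator_tau hG hc hd.mem_commutator, mul_assoc, inv_mul_eq_iff_eq_mul] at e
  exact e.symm

theorem act_self_tau {c : G} (hc : c ∈ commutator G) (a : G) :
    P.act a (P.tau c a) = P.tau c a * P.tau (rcomm c a) a := by
  have hz := rcomm_mem_center hG hc a
  rw [P.act_tau, rconj_eq_self (Commute.refl a), rconj_eq_mul_rcomm, P.tau_mul_left,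
    P.act_center _ hz]

variable {n : ℕ} (hn : ∀ x : G, x ^ n = 1)
include hn

theorem tau_pow_choose_two {c : G} (hc : c ∈ commutator G) (x : G) :
    P.tau c x ^ n.choose 2 = 1 := by
  rw [← P.tau_pow_left (P.act_commutator_tau hG hc hc x), commutator_pow_choose_two hG hn hc,
    tau_one_left]

/-- The action of `g` is unipotent on the commuting elements `t`, `u`, `v`, namely `t ↦ tu`, `u ↦
uv`, `v ↦ v`, whence the binomial exponents in `g ^ j ⊗ h`. At `j = n` the factors in `u` and `v`
vanish. -/
theorem tau_pow (g h : G) : P.tau g h ^ n = 1 := by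
  have hc := rcomm_mem_commutator g h
  have hz := hG g h g
  have hz' := rcomm_mem_commutator (rcomm g h) g
  set c := rcomm g h with hcdef
  set z := rcomm c g with hzdef
  set t := P.tau g h with ht
  set u := P.tau c g with hu
  set v := P.tau z g with hv
  have at' : P.act g t = t * u := P.act_tau_eq_mul g h g
  have au : P.act g u = u * v := P.act_self_tau hG hc g
  have av : P.act g v = v := by
    rw [hv, P.act_tau, rconj_eq_self (Commute.refl g),
      rconj_eq_self (Subgroup.mem_center_iff.1 hz g).symm]
  have tu : Commute t u := P.commute_tau hG hc g (P.tau_mem g h)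
  have tv : Commute t v := P.commute_tau hG hz' g (P.tau_mem g h)
  have uv : Commute u v := P.commute_tau hG hz' g (P.tau_mem c g)
  have key : ∀ j : ℕ, P.tau (g ^ j) h = t ^ j * u ^ j.choose 2 * v ^ j.choose 3 := by
    intro j
    induction j with
    | zero => simp
    | succ j ih =>
      have hc2 : (j + 1).choose 2 = j + j.choose 2 := by
        rw [Nat.choose_succ_succ' j 1, Nat.choose_one_right]
      have hc3 : (j + 1).choose 3 = j.choose 2 + j.choose 3 := Nat.choose_succ_succ' j 2
      have ct : Commute (u ^ (j + j.choose 2) * v ^ (j.choose 2 + j.choose 3)) t :=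
        (tu.symm.pow_left _).mul_left (tv.symm.pow_left _)
      calc P.tau (g ^ (j + 1)) h = P.act g (P.tau (g ^ j) h) * t := by
            rw [pow_succ, P.tau_mul_left]
        _ = (t * u) ^ j * (u * v) ^ j.choose 2 * v ^ j.choose 3 * t := by
            rw [ih, map_mul, map_mul, map_pow, map_pow, map_pow, at', au, av]
        _ = t ^ j * ((u ^ (j + j.choose 2) * v ^ (j.choose 2 + j.choose 3)) * t) := by
            rw [tu.mul_pow, uv.mul_pow, pow_add, pow_add]; simp only [mul_assoc]
        _ = _ := by rw [ct.eq, hc2, hc3, pow_succ]; simp only [mul_assoc]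
  have e := key n
  have hvn : v ^ n.choose 3 = 1 := by
    rw [hv, ← P.tau_pow_left (P.act_center z hz _), hzdef, hcdef,
      ← inv_inv (rcomm _ g), ← rcomm_rcomm_eq_inv hG, inv_pow,
      rcomm_rcomm_pow_choose_three hG hn, inv_one, tau_one_left]
  rw [hn, tau_one_left, hu, P.tau_pow_choose_two hG hn hc, hvn, mul_one, mul_one] at e
  exact e.symm

/-- For products, `x` and `y` commute up to `d ⊗ c`, which is central in the range and killed by
`n.choose 2`. -/
theorem pow_eq_one_of_mem {m : T} (hm : m ∈ P.range) : m ^ n = 1 := by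
  induction hm using Subgroup.closure_induction with
  | mem x hx =>
    obtain ⟨g, h, rfl⟩ := hx
    exact P.tau_pow hG hn g h
  | one => exact one_pow n
  | mul x y hx hy ihx ihy =>
    obtain ⟨c, hc⟩ := P.exists_over_of_mem hx
    obtain ⟨d, hd⟩ := P.exists_over_of_mem hy
    have comm : y * x = x * y * P.tau d c := by
      have e := hc.conj_eq y hy
      rw [hd.act_eq, mul_assoc, inv_mul_eq_iff_eq_mul, ← mul_assoc] at e
      exact e
    have cx := P.commute_tau hG hd.mem_commutator c hx
    have cy := P.commute_tau hG hd.mem_commutator c hy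
    have key : ∀ j : ℕ, (x * y) ^ j = x ^ j * y ^ j * P.tau d c ^ j.choose 2 := by
      intro j
      induction j with
      | zero => simp
      | succ j ih =>
        have hc2 : (j + 1).choose 2 = j + j.choose 2 := by
          rw [Nat.choose_succ_succ' j 1, Nat.choose_one_right]
        have hyj : y ^ j * x = x * y ^ j * P.tau d c ^ j := by
          have h1 := cx.symm.eq
          have : rconj y x = y * P.tau d c := by
            rw [rconj, mul_assoc, comm]; group
          have h2 : rconj (y ^ j) x = (y * P.tau d c) ^ j := by
            rw [← this]; exact map_pow (rconjHom x) y j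
          rw [cy.mul_pow, rconj, mul_assoc, inv_mul_eq_iff_eq_mul, ← mul_assoc] at h2
          exact h2
        calc (x * y) ^ (j + 1)
            = x ^ j * y ^ j * (P.tau d c ^ j.choose 2 * (x * y)) := by
              rw [pow_succ, ih]; simp only [mul_assoc]
          _ = x ^ j * (y ^ j * x) * y * P.tau d c ^ j.choose 2 := by
              rw [((cx.mul_left cy).symm.pow_left _).eq]; simp only [mul_assoc]
          _ = x ^ (j + 1) * y ^ j * (P.tau d c ^ j * y) * P.tau d c ^ j.choose 2 := by
              rw [hyj, pow_succ]; simp only [mul_assoc]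
          _ = _ := by
              rw [(cy.symm.pow_left j).eq, hc2, pow_add (P.tau d c), pow_succ y]; simp only [mul_assoc]
    rw [key, ihx, ihy, P.tau_pow_choose_two hG hn hd.mem_commutator, one_mul, one_mul]
  | inv x _ hx => rw [inv_pow, hx, inv_one]

/-- If conjugation by `y` agrees with the action of `a` on the range of the pairing and
`[c, a] ⊗ a` is trivial for `c` in the derived subgroup, then `(y * m) ^ n = y ^ n`. -/
theorem mul_pow_eq_of_conj {y m : T} {a : G} (hm : m ∈ P.range)
    (hy : ∀ s ∈ P.range, y⁻¹ * s * y = P.act a s)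
    (ha : ∀ c ∈ commutator G, P.tau (rcomm c a) a = 1) : (y * m) ^ n = y ^ n := by
  obtain ⟨c, hc⟩ := P.exists_over_of_mem hm
  set u := P.tau c a with hu
  have hum : u ∈ P.range := P.tau_mem c a
  have mu : Commute m u := P.commute_tau hG hc.mem_commutator a hm
  have am : P.act a m = m * u := hc.act_eq a
  -- With `u` fixed by `a`, collection stops at `u ^ n.choose 2`, with no further term.
  have au : P.act a u = u := by
    rw [hu, P.act_self_tau hG hc.mem_commutator, ha c hc.mem_commutator, mul_one]
  have key : ∀ j : ℕ, (y * m) ^ j = y ^ j * (m ^ j * u ^ j.choose 2) := by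
    intro j
    induction j with
    | zero => simp
    | succ j ih =>
      have hc2 : (j + 1).choose 2 = j + j.choose 2 := by
        rw [Nat.choose_succ_succ' j 1, Nat.choose_one_right]
      have e := hy (m ^ j * u ^ j.choose 2) (mul_mem (pow_mem hm _) (pow_mem hum _))
      rw [map_mul, map_pow, map_pow, am, au, mu.mul_pow, mul_assoc, inv_mul_eq_iff_eq_mul] at e
      calc (y * m) ^ (j + 1) = y ^ j * (m ^ j * u ^ j.choose 2 * y) * m := by
            rw [pow_succ, ih]; simp only [mul_assoc]
        _ = y ^ j * y * m ^ j * (u ^ (j + j.choose 2) * m) := by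
            rw [e, pow_add]; simp only [mul_assoc]
        _ = _ := by
            rw [(mu.symm.pow_left _).eq, hc2, pow_succ y, pow_succ m]; simp only [mul_assoc]
  rw [key, P.pow_eq_one_of_mem hG hn hm, hu, P.tau_pow_choose_two hG hn hc.mem_commutator,
    mul_one, mul_one]

end ClassThree

end TensorPairing

/-! ### The presented group as a tensor pairing. -/

section Presentation

variable {G : Type*} [Group G] {q : ℕ}

/-- The class of the symbol `g ⊗ h`. -/
def mkTens (q : ℕ) (g h : G) : QTensorSquare G q := PresentedGroup.of (Gen.tens g h)

/-- The class of the symbol `k̂`. -/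
def mkHat (hq : 1 ≤ q) (k : G) : QTensorSquare G q := PresentedGroup.of (Gen.hat hq k)

/-- The correction factor relating `mkHat hq (k * k₁)` to `mkHat hq k` and `mkHat hq k₁`. -/
def hatCocycle (q : ℕ) (k k₁ : G) : QTensorSquare G q :=
  ((List.range' 1 (q - 1)).map fun i => mkTens q k (rconj (k₁ ^ i)⁻¹ (k ^ (q - 1 - i)))).prod

theorem mk_eq_of_rel {u v : FreeGroup (Gen G q)} (h : Rel G q u v) :
    PresentedGroup.mk {w : FreeGroup (Gen G q) | ∃ u v, Rel G q u v ∧ w = u * v⁻¹} u =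
      PresentedGroup.mk _ v := by
  rw [← mul_inv_eq_one, ← map_inv, ← map_mul]
  exact PresentedGroup.one_of_mem ⟨u, v, h, rfl⟩

theorem mkTens_mul_right (g h h₁ : G) :
    mkTens q g (h * h₁) = mkTens q g h₁ * mkTens q (rconj g h₁) (rconj h h₁) :=
  mk_eq_of_rel (Rel.mul_right g h h₁)

theorem mkTens_mul_left (g g₁ h : G) :
    mkTens q (g * g₁) h = mkTens q (rconj g g₁) (rconj h g₁) * mkTens q g₁ h :=
  mk_eq_of_rel (Rel.mul_left g g₁ h)

theorem rconj_mkTens_mkHat (hq : 1 ≤ q) (g h k : G) :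
    rconj (mkTens q g h) (mkHat hq k) = mkTens q (rconj g (k ^ q)) (rconj h (k ^ q)) :=
  mk_eq_of_rel (Rel.conj_hat hq g h k)

theorem mkHat_mul (hq : 1 ≤ q) (k k₁ : G) :
    mkHat hq (k * k₁) = mkHat hq k * hatCocycle q k k₁ * mkHat hq k₁ := by
  have := mk_eq_of_rel (Rel.hat_mul hq k k₁)
  rw [map_mul, map_mul, map_list_prod, List.map_map] at this
  exact this

theorem rcomm_mkHat (hq : 1 ≤ q) (k k₁ : G) :
    rcomm (mkHat hq k) (mkHat hq k₁) = mkTens q (k ^ q) (k₁ ^ q) :=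
  mk_eq_of_rel (Rel.comm_hat hq k k₁)

theorem mkHat_rcomm (hq : 1 ≤ q) (g h : G) : mkHat hq (rcomm g h) = mkTens q g h ^ q :=
  mk_eq_of_rel (Rel.hat_comm hq g h)

/-- The image of a generator under the map induced by a homomorphism of groups. -/
def Gen.mapMk {H : Type*} [Group H] (f : G →* H) : Gen G q → QTensorSquare H q
  | .tens g h => mkTens q (f g) (f h)
  | .hat hq k => mkHat hq (f k)

/-- Functoriality of the `q`-tensor square. -/
def mapHom {H : Type*} [Group H] (q : ℕ) (f : G →* H) : QTensorSquare G q →* QTensorSquare H q :=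
  PresentedGroup.toGroup (f := Gen.mapMk f) (by
    rintro _ ⟨u, v, huv, rfl⟩
    rw [map_mul, map_inv, mul_inv_eq_one]
    cases huv with
    | mul_right g h h₁ =>
      simp only [map_mul, tens, FreeGroup.lift_apply_of, Gen.mapMk, map_rconj]
      exact mkTens_mul_right _ _ _
    | mul_left g g₁ h =>
      simp only [map_mul, tens, FreeGroup.lift_apply_of, Gen.mapMk, map_rconj]
      exact mkTens_mul_left _ _ _
    | conj_hat hq g h k =>
      simp only [map_pow, tens, hat, FreeGroup.lift_apply_of, Gen.mapMk, map_rconj]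
      exact rconj_mkTens_mkHat hq _ _ _
    | hat_mul hq k k₁ =>
      simp only [map_mul, map_pow, map_inv, tens, hat, FreeGroup.lift_apply_of, Gen.mapMk,
        map_rconj, map_list_prod, List.map_map, Function.comp_def]
      exact mkHat_mul hq _ _
    | comm_hat hq k k₁ =>
      simp only [map_pow, tens, hat, FreeGroup.lift_apply_of, Gen.mapMk, map_rcomm]
      exact rcomm_mkHat hq _ _
    | hat_comm hq g h =>
      simp only [map_pow, tens, hat, FreeGroup.lift_apply_of, Gen.mapMk, map_rcomm]
      exact mkHat_rcomm hq _ _)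

@[simp] theorem mapHom_mkTens {H : Type*} [Group H] (f : G →* H) (g h : G) :
    mapHom q f (mkTens q g h) = mkTens q (f g) (f h) :=
  PresentedGroup.toGroup.of _

@[simp] theorem mapHom_mkHat {H : Type*} [Group H] (f : G →* H) (hq : 1 ≤ q) (k : G) :
    mapHom q f (mkHat hq k) = mkHat hq (f k) :=
  PresentedGroup.toGroup.of _

theorem hom_ext {K : Type*} [Group K] {f₁ f₂ : QTensorSquare G q →* K}
    (ht : ∀ g h, f₁ (mkTens q g h) = f₂ (mkTens q g h))
    (hh : ∀ (hq : 1 ≤ q) k, f₁ (mkHat hq k) = f₂ (mkHat hq k)) : f₁ = f₂ := by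
  apply PresentedGroup.ext
  rintro (⟨g, h⟩ | ⟨hq, k⟩)
  · exact ht g h
  · exact hh hq k

/-- The tensor pairing of the `q`-tensor square. -/
def tensorPairing (G : Type*) [Group G] (q : ℕ) : TensorPairing G (QTensorSquare G q) where
  tau := mkTens q
  act k := mapHom q (rconjHom k)
  act_tau k g h := mapHom_mkTens _ g h
  act_mul a b t := by
    rw [← MonoidHom.comp_apply]
    congr 1
    refine hom_ext (fun g h => ?_) (fun hq k => ?_)
    · simp [rconjHom, rconj_mul_right]
    · simp [rconjHom, rconj_mul_right]
  act_center x hx t := by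
    have : rconjHom x = MonoidHom.id G := by
      ext a
      exact rconj_eq_self (Subgroup.mem_center_iff.1 hx a)
    rw [this]
    conv_rhs => rw [← MonoidHom.id_apply (QTensorSquare G q) t]
    congr 1
    exact hom_ext (by simp) (by simp)
  tau_mul_right g h h₁ := by
    rw [mapHom_mkTens]; exact mkTens_mul_right g h h₁
  tau_mul_left g g₁ h := by
    rw [mapHom_mkTens]; exact mkTens_mul_left g g₁ h

-- Hats modulo the tensor subgroup.

local notation "τ" => TensorPairing.range (tensorPairing G q)

theorem conj_mkHat (hq : 1 ≤ q) (k : G) {s : QTensorSquare G q} (hs : s ∈ τ) :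
    (mkHat hq k)⁻¹ * s * mkHat hq k = (tensorPairing G q).act (k ^ q) s := by
  induction hs using Subgroup.closure_induction with
  | mem x hx =>
    obtain ⟨g, h, rfl⟩ := hx
    rw [(tensorPairing G q).act_tau]
    exact rconj_mkTens_mkHat hq g h k
  | one => simp
  | mul x y _ _ hx hy => rw [map_mul, ← hx, ← hy]; group
  | inv x _ hx => rw [map_inv, ← hx]; group

theorem mkHat_one (hq : 1 ≤ q) : mkHat hq (1 : G) = 1 := by
  have h := mkHat_mul hq (1 : G) 1
  have h1 : hatCocycle q (1 : G) 1 = 1 := by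
    refine List.prod_eq_one fun x hx => ?_
    obtain ⟨i, -, rfl⟩ := List.mem_map.1 hx
    exact (tensorPairing G q).tau_one_left _
  rw [h1, mul_one, mul_one] at h
  exact left_eq_mul.1 h

theorem hatCocycle_mem (k k₁ : G) : hatCocycle q k k₁ ∈ τ := by
  refine Subgroup.list_prod_mem _ fun x hx => ?_
  obtain ⟨i, -, rfl⟩ := List.mem_map.1 hx
  exact (tensorPairing G q).tau_mem _ _

theorem mul_mkHat (hq : 1 ≤ q) (k : G) {s : QTensorSquare G q} (hs : s ∈ τ) :
    s * mkHat hq k = mkHat hq k * (tensorPairing G q).act (k ^ q) s := by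
  rw [← conj_mkHat hq k hs]; group

/-- Hats multiply up to a factor in `τ`, and conjugation by a hat maps `τ` into itself. -/
theorem exists_eq_mkHat_mul (hq : 1 ≤ q) (w : QTensorSquare G q) :
    ∃ k, ∃ m ∈ τ, w = mkHat hq k * m := by
  have mul_hat : ∀ (w : QTensorSquare G q) (k₁ : G), (∃ k, ∃ m ∈ τ, w = mkHat hq k * m) →
      ∃ k, ∃ m ∈ τ, w * mkHat hq k₁ = mkHat hq k * m := by
    rintro _ k₁ ⟨k, m, hm, rfl⟩
    have hC := inv_mem (hatCocycle_mem (q := q) k k₁)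
    refine ⟨k * k₁, (tensorPairing G q).act (k₁ ^ q) ((hatCocycle q k k₁)⁻¹ * m),
      (tensorPairing G q).act_mem _ (mul_mem hC hm), ?_⟩
    rw [mkHat_mul, mul_assoc _ (mkHat hq k₁), ← mul_mkHat hq k₁ (mul_mem hC hm)]
    group
  have hat_inv : ∀ k₁ : G, (mkHat hq k₁)⁻¹ = hatCocycle q k₁ k₁⁻¹ * mkHat hq k₁⁻¹ := by
    intro k₁
    have := mkHat_mul hq k₁ k₁⁻¹
    rw [mul_inv_cancel, mkHat_one, mul_assoc] at this
    exact inv_eq_of_mul_eq_one_right this.symm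
  have hgen : w ∈ Subgroup.closure (Set.range (PresentedGroup.of
      (rels := {w : FreeGroup (Gen G q) | ∃ u v, Rel G q u v ∧ w = u * v⁻¹}))) := by
    rw [PresentedGroup.closure_range_of]; trivial
  induction hgen using Subgroup.closure_induction_right with
  | one => exact ⟨1, 1, one_mem _, by rw [mkHat_one, mul_one]⟩
  | mul_right x _ y hy ih =>
    obtain ⟨_ | _, rfl⟩ := hy
    · obtain ⟨k, m, hm, rfl⟩ := ih
      exact ⟨k, m * _, mul_mem hm ((tensorPairing G q).tau_mem _ _), mul_assoc _ _ _⟩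
    · exact mul_hat _ _ ih
  | mul_inv_cancel x _ y hy ih =>
    obtain ⟨_ | _, rfl⟩ := hy
    · obtain ⟨k, m, hm, rfl⟩ := ih
      exact ⟨k, m * _, mul_mem hm (inv_mem ((tensorPairing G q).tau_mem _ _)), mul_assoc _ _ _⟩
    · rename_i _ k₁
      change ∃ k, ∃ m ∈ τ, x * (mkHat hq k₁)⁻¹ = _
      rw [hat_inv, ← mul_assoc]
      obtain ⟨k, m, hm, rfl⟩ := ih
      exact mul_hat _ _ ⟨k, m * _, mul_mem hm (hatCocycle_mem k₁ k₁⁻¹), mul_assoc _ _ _⟩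

theorem range_eq_top_of_eq_zero (hq : q = 0) : τ = ⊤ := by
  rw [eq_top_iff, ← PresentedGroup.closure_range_of, Subgroup.closure_le]
  rintro _ ⟨_ | ⟨hq', _⟩, rfl⟩
  · exact (tensorPairing G q).tau_mem _ _
  · omega

theorem mkTens_self_pow (k : G) (j i : ℕ) :
    mkTens q (k ^ j) (k ^ i)⁻¹ = (mkTens q k k ^ (j * i))⁻¹ := by
  have fix : ∀ x y : G, Commute k x → Commute y x → (tensorPairing G q).act x
      ((tensorPairing G q).tau k y) = (tensorPairing G q).tau k y := fun x y h h' => by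
    rw [(tensorPairing G q).act_tau, rconj_eq_self h, rconj_eq_self h']
  have hk : Commute k k := Commute.refl k
  have e1 : mkTens q k (k ^ i) = mkTens q k k ^ i :=
    (tensorPairing G q).tau_pow_right (fix k k hk hk) i
  have e2 := (tensorPairing G q).tau_mul_right k (k ^ i)⁻¹ (k ^ i)
  rw [inv_mul_cancel, TensorPairing.tau_one_right,
    fix _ _ (hk.pow_right i) (Commute.refl (k ^ i)).inv_left] at e2
  have e3 : mkTens q k (k ^ i)⁻¹ = (mkTens q k (k ^ i))⁻¹ := eq_inv_of_mul_eq_one_right e2.symm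
  have e4 : mkTens q (k ^ j) (k ^ i)⁻¹ = mkTens q k (k ^ i)⁻¹ ^ j :=
    (tensorPairing G q).tau_pow_left (fix k _ hk (hk.pow_left i).inv_left) j
  rw [e4, e3, e1, inv_pow, ← pow_mul, mul_comm]

/-- All conjugations are trivial on powers of `k`, so the factors are powers of `k ⊗ k` with
exponents `-j * i`, and `1 + ⋯ + (q - 1) = q.choose 2`. -/
theorem hatCocycle_pow_self (hq : 1 ≤ q) (k : G) (j : ℕ) :
    hatCocycle q (k ^ j) k = (mkTens q k k ^ (j * q.choose 2))⁻¹ := by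
  have h : ∀ m : ℕ, ((List.range' 1 m).map fun i => (mkTens q k k ^ (j * i))⁻¹).prod =
      (mkTens q k k ^ (j * (m + 1).choose 2))⁻¹ := by
    intro m
    induction m with
    | zero => simp
    | succ m ih =>
      rw [List.range'_1_concat, List.map_append, List.prod_append, ih, List.map_singleton,
        List.prod_singleton, ← mul_inv_rev, ← pow_add, ← mul_add, Nat.choose_succ_succ' (m + 1) 1,
        Nat.choose_one_right, add_comm 1 m]
  have e := h (q - 1)
  rw [Nat.sub_add_cancel hq] at e
  rw [← e, hatCocycle]
  congr 1
  refine List.map_congr_left fun i _ => ?_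
  rw [rconj_eq_self, mkTens_self_pow]
  exact ((Commute.refl k).pow_pow _ _).pow_right _ |>.inv_left

theorem mkHat_pow (hq : 1 ≤ q) (k : G) (j : ℕ) :
    mkHat hq (k ^ j) = mkHat hq k ^ j * (mkTens q k k ^ (q.choose 2 * j.choose 2))⁻¹ := by
  have hs : Commute (mkTens q k k) (mkHat hq k) := by
    have e := rconj_mkTens_mkHat hq k k k
    rw [rconj_eq_self (Commute.self_pow k q), rconj, mul_assoc, inv_mul_eq_iff_eq_mul] at e
    exact e
  induction j with
  | zero => simp [mkHat_one]
  | succ j ih =>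
    rw [pow_succ, mkHat_mul, ih, hatCocycle_pow_self hq, mul_assoc (mkHat hq k ^ j),
      ← mul_inv_rev, ← pow_add, mul_assoc, ((hs.pow_left _).inv_left).eq, ← mul_assoc,
      ← pow_succ, Nat.choose_succ_succ' j 1, Nat.choose_one_right]
    congr 3
    ring

theorem rcomm_rcomm_mem_center [Group.IsNilpotent G] (hclass : Group.nilpotencyClass G ≤ 3)
    (a b c : G) : rcomm (rcomm a b) c ∈ Subgroup.center G := by
  have step : ∀ (i : ℕ) (x y : G), x ∈ (⊤ : Subgroup G).lowerCentralSeries i →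
      rcomm x y ∈ (⊤ : Subgroup G).lowerCentralSeries (i + 1) := by
    intro i x y hx
    have h := Subgroup.commutator_mem_commutator (inv_mem hx) (Subgroup.mem_top (y⁻¹ : G))
    simpa [rcomm, commutatorElement_def] using h
  -- The series is indexed from zero, so this is the vanishing of four-fold commutators.
  have h3 : (⊤ : Subgroup G).lowerCentralSeries 3 = ⊥ :=
    Subgroup.lowerCentralSeries_eq_bot_iff_nilpotencyClass_le.2 hclass
  rw [Subgroup.mem_center_iff]
  intro x
  have h := step 2 _ x (step 1 _ c (step 0 a b (Subgroup.mem_top a)))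
  rw [h3, Subgroup.mem_bot] at h
  have e := mul_eq_mul_rcomm (rcomm (rcomm a b) c) x
  rw [h, mul_one] at e
  exact e.symm

/-! ### The exponent bounds. -/

section Exponent

variable (hG : ∀ a b c : G, rcomm (rcomm a b) c ∈ Subgroup.center G) {n : ℕ}
  (hn : ∀ x : G, x ^ n = 1)
include hG hn

theorem pow_eq_one_of_eq_zero (hq : q = 0) (w : QTensorSquare G q) : w ^ n = 1 :=
  (tensorPairing G q).pow_eq_one_of_mem hG hn (by rw [range_eq_top_of_eq_zero hq]; trivial)

theorem exists_pow_eq_mkTens_pow (hq : 1 ≤ q) (w : QTensorSquare G q) :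
    ∃ k, w ^ n = mkTens q k k ^ (q.choose 2 * n.choose 2) := by
  obtain ⟨k, m, hm, rfl⟩ := exists_eq_mkHat_mul hq w
  refine ⟨k, ?_⟩
  rw [(tensorPairing G q).mul_pow_eq_of_conj hG hn hm (fun s hs => conj_mkHat hq k hs)]
  · have e := mkHat_pow hq k n
    rw [hn, mkHat_one] at e
    exact (mul_inv_eq_one.1 e.symm)
  · intro c hc
    have hz := rcomm_mem_center hG hc (k ^ q)
    have hz' : rcomm (rcomm c (k ^ q)) k = 1 := by
      rw [rcomm, mul_assoc, mul_assoc, ← Subgroup.mem_center_iff.1 hz k]; group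
    -- With `z = [c, k^q]` central, `z ⊗ k^q = (z ⊗ k)^q`, which relation (6) identifies with the
    -- hat of `[z, k] = 1`.
    rw [(tensorPairing G q).tau_pow_right]
    · exact (mkHat_rcomm hq _ k).symm.trans (by rw [hz', mkHat_one])
    · rw [(tensorPairing G q).act_tau, rconj_eq_self (Commute.refl k),
        rconj_eq_self (Subgroup.mem_center_iff.1 hz k).symm]

theorem pow_eq_one_of_dvd (h : n ∣ q.choose 2 * n.choose 2) (w : QTensorSquare G q) :
    w ^ n = 1 := by
  rcases Nat.eq_zero_or_pos q with hq | hq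
  · exact pow_eq_one_of_eq_zero hG hn hq w
  · obtain ⟨k, hk⟩ := exists_pow_eq_mkTens_pow hG hn hq w
    obtain ⟨r, hr⟩ := h
    have e : mkTens q k k ^ n = 1 := (tensorPairing G q).tau_pow hG hn k k
    rw [hk, hr, pow_mul, e, one_pow]

theorem pow_two_mul_eq_one (w : QTensorSquare G q) : w ^ (2 * n) = 1 := by
  rw [mul_comm, pow_mul]
  rcases Nat.eq_zero_or_pos q with hq | hq
  · rw [pow_eq_one_of_eq_zero hG hn hq w, one_pow]
  · obtain ⟨k, hk⟩ := exists_pow_eq_mkTens_pow hG hn hq w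
    have e : mkTens q k k ^ n = 1 := (tensorPairing G q).tau_pow hG hn k k
    have hc : q.choose 2 * n.choose 2 * 2 = n * ((n - 1) * q.choose 2) := by
      have h2 : n.choose 2 * 2 = n * (n - 1) := by
        rw [Nat.choose_two_right, Nat.div_mul_cancel (Nat.even_mul_pred_self n).two_dvd]
      rw [mul_assoc, h2]; ring
    rw [hk, ← pow_mul, hc, pow_mul, e, one_pow]

end Exponent

/-- For odd `n` already `n ∣ n.choose 2`. If `4 ∣ q`, then `q.choose 2` is even and supplies the
factor in `2 * n.choose 2 = n * (n - 1)`. -/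
theorem dvd_choose_two_mul_choose_two {n q : ℕ} (h : Odd n ∨ 4 ∣ q) :
    n ∣ q.choose 2 * n.choose 2 := by
  have hn : n.choose 2 * 2 = n * (n - 1) := by
    rw [Nat.choose_two_right, Nat.div_mul_cancel (Nat.even_mul_pred_self n).two_dvd]
  rcases h with ⟨r, rfl⟩ | ⟨r, rfl⟩
  · refine Dvd.dvd.mul_left ⟨r, ?_⟩ _
    have : (2 * r + 1).choose 2 * 2 = (2 * r + 1) * r * 2 := by
      rw [hn, Nat.add_sub_cancel]; ring
    omega
  · have hq : (4 * r).choose 2 = r * (4 * r - 1) * 2 := by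
      rw [Nat.choose_two_right]
      apply Nat.div_eq_of_eq_mul_left two_pos
      ring
    rw [hq, mul_assoc, mul_comm 2, hn]
    exact Dvd.dvd.mul_left (Dvd.intro _ rfl) _

end Presentation

end QTensor

theorem mainTheorem2 {G : Type*} [Group G] [Finite G] [Group.IsNilpotent G]
    (hclass : Group.nilpotencyClass G ≤ 3) (n : ℕ) (hn : Monoid.exponent G = n) (q : ℕ) :
    ((Odd n ∨ 4 ∣ q) → Monoid.exponent (QTensorSquare G q) ∣ n) ∧
      (¬(Odd n ∨ 4 ∣ q) → Monoid.exponent (QTensorSquare G q) ∣ 2 * n) := by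
  have hG := QTensor.rcomm_rcomm_mem_center hclass
  have hn' : ∀ x : G, x ^ n = 1 := fun x => hn ▸ Monoid.pow_exponent_eq_one x
  exact ⟨fun h => Monoid.exponent_dvd_of_forall_pow_eq_one
      (QTensor.pow_eq_one_of_dvd hG hn' (QTensor.dvd_choose_two_mul_choose_two h)),
    fun _ => Monoid.exponent_dvd_of_forall_pow_eq_one (QTensor.pow_two_mul_eq_one hG hn')⟩
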